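/- A bargaining game $B$ consists of a set of players $N=\{1,\dots,n\}$, a finite nonempty set of actions $A_i$ and a utility function $u_i\colon \prod_{j\in N}A_j\to\mathbb{R}$ for each $i\in N$, and a disagreement point $d\in\mathbb{R}^n$. Let $\Sigma_i=\Delta(A_i)$ be the set of mixed strategies of player $i$, and let $u_i(\sigma)$ be the expected utility of $i$ when the players randomize independently according to $\sigma\in\prod_{j\in N}\Sigma_j$. Assume that the utilities are additively separable: there are functions $u_{i,j}\colon A_j\to\mathbb{R}$ with $u_i(a)=\sum_{j\in N}u_{i,j}(a_j)$ for all $i$ and $a$. Fix such functions and write $u_{i,j}(\sigma_j)=\sum_{a\in A_j}\sigma_j(a)u_{i,j}(a)$ for the expected payoff that $j$ produces for $i$; let $F_j=\{(u_{i,j}(\sigma_j))_{i\in N}\mid \sigma_j\in\Sigma_j\}\subseteq\mathbb{R}^n$. For a map $\nu$ assigning to every coalition $P\subseteq N$ a set $\nu(P)\subseteq\mathbb{R}^n$, the core of $\nu$ is the set of all $x\in\nu(N)$ such that for every nonempty $P\subseteq N$ and every $y\in\nu(P)$ there is $i\in P$ with $x_i\ge y_i$. The $\alpha$-core is the core of $\nu^\alpha$,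 where $x\in\nu^\alpha(P)$ if and only if there is $\sigma_P\in\prod_{i\in P}\Sigma_i$ such that $u_i(\sigma_P,\sigma_{-P})\ge x_i$ for all $\sigma_{-P}\in\prod_{j\in N\setminus P}\Sigma_j$ and all $i\in P$. For a matrix $M\in\mathbb{R}^{n\times n}$, the $M$-core is the core of $\nu^M$, where $x\in\nu^M(P)$ if and only if there are $y_j\in F_j$ $(j\in P)$ such that $x_i\le\sum_{j\in P}y_{j,i}+\sum_{j\in N\setminus P}M_{j,i}$ for all $i\in P$. Call $\sigma_P\in\prod_{i\in P}\Sigma_i$ Pareto optimal for $P$ if, for every $\sigma'_P\in\prod_{i\in P}\Sigma_i$ with $\sum_{i\in P}u_{j,i}(\sigma'_i)\ge\sum_{i\in P}u_{j,i}(\sigma_i)$ for all $j\in P$, equality holds for all $j\in P$. Let $\Sigma_P^H$ be the set of these $\sigma_P$, and put $$A_{i,j}:=\min_{P\subseteq N,\ i\in P}\ \min_{\sigma_P\in\Sigma_P^H}u_{j,i}(\sigma_i)\qquad(i,j\in N),$$ the worst payoff that $i$ produces for $j$ in a Pareto optimal choice of strategies of a coalition containing $i$. Theorem. In every bargaining game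 with additively separable utilities, the minima that define $A$ are attained, the $A$-core is nonempty, and the $\alpha$-core is nonempty. -/

import Mathlib

/-- A (complete information) bargaining game with players `Fin n`: finite nonempty action sets,
utility functions on the outcomes (pure strategy profiles), and a disagreement point. -/
structure BargainingGame (n : ℕ) where
  Act : Fin n → Type*
  finAct : ∀ i, Fintype (Act i)
  nonemptyAct : ∀ i, Nonempty (Act i)
  /-- `u i a` is the utility of player `i` at the outcome `a`. -/
  u : Fin n → (∀ j, Act j) → ℝ
  /-- The disagreement point. -/
  d : Fin n → ℝ

attribute [instance] BargainingGame.finAct BargainingGame.nonemptyAct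

namespace BargainingGame

variable {n : ℕ} (B : BargainingGame n)

/-- `σ` is a mixed strategy profile: every `σ i` is a probability mass function on `Act i`. -/
def IsProfile (σ : ∀ i, B.Act i → ℝ) : Prop :=
  ∀ i, σ i ∈ stdSimplex ℝ (B.Act i)

/-- Expected utility of player `i` when the players randomize independently according to `σ`. -/
noncomputable def expectedUtility (i : Fin n) (σ : ∀ j, B.Act j → ℝ) : ℝ :=
  ∑ a : ∀ j, B.Act j, (∏ j, σ j (a j)) * B.u i a

/-- The `α`-effective payoff vectors of the coalition `P`: for some choice of strategies by the
members of `P`, every member `i` gets at least `x i` whatever the other players do.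
`P.piecewise σ τ` is the profile `(σ_P, τ_{-P})`; action sets are nonempty, so every choice of
strategies by `P`, or by its complement, is a part of a full profile. -/
def alphaEffective (P : Finset (Fin n)) : Set (Fin n → ℝ) :=
  {x | ∃ σ, B.IsProfile σ ∧ ∀ τ, B.IsProfile τ →
    ∀ i ∈ P, x i ≤ B.expectedUtility i (P.piecewise σ τ)}

/-- The core with respect to a map `ν` from coalitions to sets of payoff vectors: the vectors in
`ν(N)` such that no (nonempty) coalition can guarantee strictly higher payoffs to all its
members. -/
def core (ν : Finset (Fin n) → Set (Fin n → ℝ)) : Set (Fin n → ℝ) :=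
  {x | x ∈ ν Finset.univ ∧ ∀ P : Finset (Fin n), P.Nonempty → ∀ y ∈ ν P, ∃ i ∈ P, y i ≤ x i}

/-- The `α`-core. -/
def alphaCore : Set (Fin n → ℝ) := core B.alphaEffective

/-- The functions `v i j` exhibit the utilities as additively separable: `v i j` is the utility
that player `i` receives from the action of player `j`. -/
def IsSeparation (v : ∀ i j : Fin n, B.Act j → ℝ) : Prop :=
  ∀ i (a : ∀ j, B.Act j), B.u i a = ∑ j, v i j (a j)

variable (v : ∀ i j : Fin n, B.Act j → ℝ)

/-- The expected payoff that player `j`, using the mixed strategy `s`, produces for player `i`. -/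
noncomputable def contribution (i j : Fin n) (s : B.Act j → ℝ) : ℝ :=
  ∑ a, s a * v i j a

/-- The individual feasible set of player `j`: the vectors of payoffs that `j` can produce for all
players. -/
def individualFeasible (j : Fin n) : Set (Fin n → ℝ) :=
  {x | ∃ s ∈ stdSimplex ℝ (B.Act j), ∀ i, x i = B.contribution v i j s}

/-- The `A`-effective payoff vectors of the coalition `P`, where `A j i` is the payoff that a player
`j` produces for player `i` when `j` is left out of the coalition. -/
def matEffective (A : Fin n → Fin n → ℝ) (P : Finset (Fin n)) : Set (Fin n → ℝ) :=
  {x | ∃ y : Fin n → Fin n → ℝ, (∀ j ∈ P, y j ∈ B.individualFeasible v j) ∧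
    ∀ i ∈ P, x i ≤ ∑ j ∈ P, y j i + ∑ j ∈ Pᶜ, A j i}

/-- The `A`-core. -/
def matCore (A : Fin n → Fin n → ℝ) : Set (Fin n → ℝ) := core (B.matEffective v A)

/-- The strategies `σ i`, `i ∈ P`, are Pareto optimal for the coalition `P`: no other choice of
strategies by the members of `P` makes, as far as the payoffs produced inside `P` are concerned, all
members at least as well off and some member better off. Only the entries `σ i` with `i ∈ P`
matter. -/
def IsParetoOptimal (P : Finset (Fin n)) (σ : ∀ i, B.Act i → ℝ) : Prop :=
  (∀ i ∈ P, σ i ∈ stdSimplex ℝ (B.Act i)) ∧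
  ∀ σ' : ∀ i, B.Act i → ℝ, (∀ i ∈ P, σ' i ∈ stdSimplex ℝ (B.Act i)) →
    (∀ j ∈ P, ∑ i ∈ P, B.contribution v j i (σ i) ≤ ∑ i ∈ P, B.contribution v j i (σ' i)) →
    ∀ j ∈ P, ∑ i ∈ P, B.contribution v j i (σ' i) = ∑ i ∈ P, B.contribution v j i (σ i)

/-- The payoffs that player `i` produces for player `j` in the Pareto optimal strategies of the
coalition `P`. -/
def paretoPayoffs (P : Finset (Fin n)) (i j : Fin n) : Set ℝ :=
  {r | ∃ σ, B.IsParetoOptimal v P σ ∧ r = B.contribution v j i (σ i)}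

/-- The worst-case Pareto optimal payoffs: entry `(i, j)` is the minimum, over all coalitions `P`
containing `i`, of the least payoff that `i` produces for `j` in a Pareto optimal choice of
strategies of `P`. -/
noncomputable def worstCase (i j : Fin n) : ℝ :=
  (Finset.univ.filter fun P : Finset (Fin n) => i ∈ P).inf' ⟨Finset.univ, by simp⟩
    fun P => sInf (B.paretoPayoffs v P i j)

end BargainingGame

/-! Only Pareto optimal choices of a coalition need be tested for blocking, because every other
choice is weakly improved for all members by a Pareto optimal one (`exists_isParetoOptimal_ge`). In
a Pareto optimal choice each member `j` produces at least `A j i` for every player `i`, member or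
not (`IsParetoOptimal.worstCase_le`).

This makes the game balanced (`exists_unblocked_of_fintype`). Given balancing weights, let every
player mix the strategies used in the coalitions that contain that player. The coalitions with `i`
but not `j` weigh as much as those with `j` but not `i`; the former credit `i` with `A j i`, and in
the latter `j` produces at least that for `i`. So the mixture gives `i` at least the weighted
average of the coalitional payoffs. Scarf's theorem `exists_balanced_unblocked` then handles
finitely many choices, and compactness handles all of them.

Scarf's theorem comes from Scarf's lemma `exists_feasible_dominating`, proved by parity: an ordinal
pivot and a simplex pivot each have 0 or 2 outcomes, except at one starting set.

Each outsider `j` can hold a given `i` to exactly `A j i`, so whatever is `α`-effective is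
`A`-effective, and the `A`-core lies in the `α`-core. The minima are attained because Pareto
optimality passes to smaller supports, hence to limits. -/

namespace ScarfLemma

open Finset

/-! ### Ordinal pivots on dominating sets. -/

section Ordinal

variable {ι κ α : Type*} [LinearOrder α]

/-- A set `J` of columns is dominating for the rankings `c i` of the columns if no column is ranked
above the lowest member of `J` by every `c i`. -/
def Dominating (c : ι → ι ⊕ κ → α) (J : Finset (ι ⊕ κ)) : Prop :=
  ∀ l, ∃ i, ∀ j ∈ J, c i l ≤ c i j

variable [Fintype ι] [DecidableEq ι] [DecidableEq κ]

/-- All unit columns but the one with index `r`. -/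
def unitsExcept (κ : Type*) [DecidableEq κ] (r : ι) : Finset (ι ⊕ κ) :=
  (univ.erase r).image Sum.inl

lemma mem_unitsExcept {r : ι} {m : ι ⊕ κ} :
    m ∈ unitsExcept κ r ↔ ∃ i, i ≠ r ∧ Sum.inl i = m := by
  simp [unitsExcept]

variable [Fintype κ]

-- In a row `s ≠ r` the lowest member is `Sum.inl s`, the bottom of that row. Hence only row `r` can
-- rule out the columns outside, and the added column must be the highest of them there.
open Classical in
lemma card_dominating_insert_unitsExcept
    {c : ι → ι ⊕ κ → α} (hc : ∀ i, Function.Injective (c i))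
    (h1 : ∀ i m, m ≠ Sum.inl i → c i (Sum.inl i) < c i m)
    (h2 : ∀ i j k, j ≠ i → c i (Sum.inr k) < c i (Sum.inl j)) (r : ι) :
    (univ.filter fun k => k ∉ unitsExcept κ r ∧ Dominating c (insert k (unitsExcept κ r))).card
      = 1 := by
  have hr : (Sum.inl r : ι ⊕ κ) ∉ unitsExcept κ r := by
    rw [mem_unitsExcept]
    rintro ⟨i, hi, h⟩
    exact hi (Sum.inl.inj h)
  obtain ⟨k, hk, hmax⟩ := Finset.exists_max_image (univ.filter fun k => k ∉ unitsExcept κ r) (c r)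
    ⟨Sum.inl r, by simp [hr]⟩
  simp only [mem_filter, mem_univ, true_and] at hk hmax
  rw [Finset.card_eq_one]
  refine ⟨k, ?_⟩
  ext k'
  simp only [mem_filter, mem_univ, true_and, mem_singleton]
  constructor
  · rintro ⟨hk', hd⟩
    obtain ⟨s, hs⟩ := hd k
    have hsr : s = r := by
      by_contra hsr
      have := hs (Sum.inl s) (mem_insert_of_mem (mem_unitsExcept.2 ⟨s, hsr, rfl⟩))
      have hne : k ≠ Sum.inl s := by
        rintro rfl
        exact hk (mem_unitsExcept.2 ⟨s, hsr, rfl⟩)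
      exact absurd (h1 s k hne) (not_lt.2 this)
    subst hsr
    exact hc s (le_antisymm (hmax k' hk') (hs k' (mem_insert_self _ _)))
  · rintro rfl
    refine ⟨hk, fun l => ?_⟩
    by_cases hl : l ∈ unitsExcept κ r
    · obtain ⟨i, hi, rfl⟩ := mem_unitsExcept.1 hl
      refine ⟨i, fun j _ => ?_⟩
      by_cases hj : j = Sum.inl i
      · rw [hj]
      · exact (h1 i j hj).le
    · refine ⟨r, fun j hj => ?_⟩
      rcases mem_insert.1 hj with rfl | hj
      · exact hmax l hl
      · obtain ⟨i, hi, rfl⟩ := mem_unitsExcept.1 hj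
        rcases l with l | l
        · have : l = r := by
            by_contra h
            exact hl (mem_unitsExcept.2 ⟨l, h, rfl⟩)
          subst this
          exact (h1 l _ (by simpa using hi)).le
        · exact (h2 r i l hi).le

-- The count is 0 or 2. In a dominating set of `|ι|` columns each column is lowest in exactly one
-- row. Removing one leaves exactly two rows that share a lowest member; a replacement must become
-- lowest in one of these two, and each admits a single replacement.
open Classical in
lemma even_card_dominating_insert
    {c : ι → ι ⊕ κ → α} (hc : ∀ i, Function.Injective (c i))
    (h2 : ∀ i j k, j ≠ i → c i (Sum.inr k) < c i (Sum.inl j))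
    {E : Finset (ι ⊕ κ)} (hE : E.card + 1 = Fintype.card ι)
    {q : κ} (hq : Sum.inr q ∈ E) :
    Even (univ.filter fun k => k ∉ E ∧ Dominating c (insert k E)).card := by
  rcases Finset.eq_empty_or_nonempty (univ.filter fun k => k ∉ E ∧ Dominating c (insert k E))
    with h | ⟨j, hj⟩
  · simp [h]
  simp only [mem_filter, mem_univ, true_and] at hj
  obtain ⟨hjE, hjd⟩ := hj
  have hmin : ∀ i, ∃ e ∈ E, ∀ e' ∈ E, c i e ≤ c i e' := fun i =>
    Finset.exists_min_image E (c i) ⟨_, hq⟩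
  choose a haE ha using hmin
  have ha_eq : ∀ i e, e ∈ E → (∀ e' ∈ E, c i e ≤ c i e') → a i = e := fun i e he h =>
    hc i (le_antisymm (ha i e he) (h _ (haE i)))
  -- the rows in which the members of `insert j E` are lowest
  choose ρ hρ using hjd
  have hρa : ∀ e ∈ E, a (ρ e) = e := fun e he =>
    ha_eq _ _ he fun e' he' => hρ e e' (mem_insert_of_mem he')
  have hρj : ∀ e ∈ E, ρ e ≠ ρ j := by
    intro e he h
    have e1 := hρ e j (mem_insert_self _ _)
    have e2 := hρ j e (mem_insert_of_mem he)
    rw [h] at e1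
    exact hjE (hc _ (le_antisymm e1 e2) ▸ he)
  set i0 := ρ j with hi0
  set i1 := ρ (a i0) with hi1
  have h01 : i1 ≠ i0 := hρj _ (haE _)
  have ha01 : a i1 = a i0 := hρa _ (haE _)
  have hρimg : E.image ρ = univ.erase i0 := by
    apply Finset.eq_of_subset_of_card_le
    · intro s hs
      obtain ⟨e, he, rfl⟩ := mem_image.1 hs
      exact mem_erase.2 ⟨hρj e he, mem_univ _⟩
    · rw [card_erase_of_mem (mem_univ _), Finset.card_univ, ← hE, Finset.card_image_of_injOn]
      · simp
      · intro e he e' he' h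
        rw [← hρa e he, ← hρa e' he', h]
  have hρa' : ∀ s, s ≠ i0 → ρ (a s) = s := by
    intro s hs
    have : s ∈ E.image ρ := by rw [hρimg]; exact mem_erase.2 ⟨hs, mem_univ _⟩
    obtain ⟨e, he, rfl⟩ := mem_image.1 this
    rw [hρa e he]
  have hinj : ∀ s t, s ≠ t → a s = a t → (s = i0 ∧ t = i1) ∨ (s = i1 ∧ t = i0) := by
    intro s t hst h
    by_cases hs : s = i0
    · left
      refine ⟨hs, ?_⟩
      have ht : t ≠ i0 := fun ht => hst (hs.trans ht.symm)
      rw [← hρa' t ht, ← h, hs]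
    · by_cases ht : t = i0
      · right
        refine ⟨?_, ht⟩
        rw [← hρa' s hs, h, ht]
      · exact absurd (by rw [← hρa' s hs, ← hρa' t ht, h]) hst
  have hno : ∀ l, ∃ s, c s l ≤ c s (a s) := fun l =>
    ⟨ρ l, hρ l _ (mem_insert_of_mem (haE _))⟩
  -- The candidates for becoming lowest in row `i` only. The column `Sum.inr q` in `E` ensures that
  -- `Sum.inl i` is one of them.
  let N : ι → Finset (ι ⊕ κ) := fun i => univ.filter fun l => ∀ s, s ≠ i → c s (a s) < c s l
  have hN : ∀ i l, l ∈ N i ↔ ∀ s, s ≠ i → c s (a s) < c s l := by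
    intro i l; simp [N]
  have hNne : ∀ i, (N i).Nonempty := fun i =>
    ⟨Sum.inl i, (hN _ _).2 fun s hs => (ha s _ hq).trans_lt (h2 s i q hs.symm)⟩
  have hkex : ∀ i, ∃ k ∈ N i, ∀ l ∈ N i, c i l ≤ c i k := fun i =>
    Finset.exists_max_image (N i) (c i) (hNne i)
  choose k hkN hkmax using hkex
  have hpart : ∀ i, i = i0 ∨ i = i1 → ∃ i', i' ≠ i ∧ a i' = a i := by
    rintro i (rfl | rfl)
    · exact ⟨i1, h01, ha01⟩
    · exact ⟨i0, h01.symm, ha01.symm⟩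
  have hgood : ∀ i, i = i0 ∨ i = i1 → k i ∉ E ∧ Dominating c (insert (k i) E) := by
    intro i hi
    obtain ⟨i', hi', hai'⟩ := hpart i hi
    have hk := (hN _ _).1 (hkN i)
    have hle : c i (k i) ≤ c i (a i) := by
      obtain ⟨s, hs⟩ := hno (k i)
      by_cases hsi : s = i
      · exact hsi ▸ hs
      · exact absurd (hk s hsi) (not_lt.2 hs)
    refine ⟨fun hkE => ?_, fun l => ?_⟩
    · have := hρa _ hkE
      by_cases hs : ρ (k i) = i
      · have h3 := hk i' hi'
        rw [hai', ← this, hs] at h3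
        exact lt_irrefl _ h3
      · have h3 := hk _ hs
        rw [this] at h3
        exact lt_irrefl _ h3
    · by_cases hl : l ∈ N i
      · refine ⟨i, fun e he => ?_⟩
        rcases mem_insert.1 he with rfl | he
        · exact hkmax i l hl
        · exact (hkmax i l hl).trans (hle.trans (ha i e he))
      · rw [hN] at hl
        push Not at hl
        obtain ⟨s, hs, hsl⟩ := hl
        refine ⟨s, fun e he => ?_⟩
        rcases mem_insert.1 he with rfl | he
        · exact hsl.trans (hk s hs).le
        · exact hsl.trans (ha s e he)
  have hset : (univ.filter fun k => k ∉ E ∧ Dominating c (insert k E)) = {k i0, k i1} := by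
    ext m
    simp only [mem_filter, mem_univ, true_and, mem_insert, mem_singleton]
    constructor
    · rintro ⟨hmE, hmd⟩
      choose τ hτ using hmd
      have hτa : ∀ e ∈ E, a (τ e) = e := fun e he =>
        ha_eq _ _ he fun e' he' => hτ e e' (mem_insert_of_mem he')
      have hτm : ∀ e ∈ E, τ e ≠ τ m := by
        intro e he h
        have e1 := hτ e m (mem_insert_self _ _)
        have e2 := hτ m e (mem_insert_of_mem he)
        rw [h] at e1
        exact hmE (hc _ (le_antisymm e1 e2) ▸ he)
      have hi : τ m = i0 ∨ τ m = i1 := by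
        have := hinj (τ m) (τ (a (τ m))) (hτm _ (haE _)).symm (hτa _ (haE _)).symm
        tauto
      have hmN : m ∈ N (τ m) := by
        rw [hN]
        intro s hs
        have hsτ : τ (a s) = s := by
          by_contra hne
          have e1 := hinj _ _ hne (hτa _ (haE s))
          have e2 := hτm _ (haE s)
          rcases hi with hi | hi <;> rcases e1 with ⟨e3, e4⟩ | ⟨e3, e4⟩ <;> simp_all
        refine lt_of_le_of_ne ?_ fun h => hmE (hc _ h ▸ haE s)
        have := hτ (a s) m (mem_insert_self _ _)
        rwa [hsτ] at this
      have hmk : m = k (τ m) := by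
        apply hc (τ m)
        apply le_antisymm (hkmax _ _ hmN)
        have hk := (hN _ _).1 (hkN (τ m))
        have hs := hτ (k (τ m))
        by_cases hsi : τ (k (τ m)) = τ m
        · rw [hsi] at hs
          exact hs _ (mem_insert_self _ _)
        · exact absurd (hk _ hsi) (not_lt.2 (hs _ (mem_insert_of_mem (haE _))))
      rcases hi with hi | hi
      · left; rw [hmk, hi]
      · right; rw [hmk, hi]
    · rintro (rfl | rfl)
      · exact hgood _ (Or.inl rfl)
      · exact hgood _ (Or.inr rfl)
  -- A common value would lie above the lowest member of `E` in every row, against `hno`.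
  have hne : k i0 ≠ k i1 := by
    intro h
    obtain ⟨s, hs⟩ := hno (k i0)
    by_cases hsi : s = i0
    · have := (hN _ _).1 (hkN i1) s (by rw [hsi]; exact h01.symm)
      rw [← h] at this
      exact absurd this (not_lt.2 hs)
    · exact absurd ((hN _ _).1 (hkN i0) s hsi) (not_lt.2 hs)
  rw [hset, Finset.card_pair hne]
  exact even_two

end Ordinal

/-! ### Simplex pivots on feasible sets. -/

section Feasible

variable {M ι : Type*} [Fintype M]

/-- A set `J` of columns is feasible for the right-hand side `b` if `b` is a nonnegative combination
of the columns in `J`. -/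
def Feasible (B : M → ι → ℝ) (b : ι → ℝ) (J : Finset M) : Prop :=
  ∃ α : M → ℝ, (∀ m, 0 ≤ α m) ∧ (∀ m ∉ J, α m = 0) ∧ ∑ m, α m • B m = b

/-- The vector `b` is in the span of no family of fewer than `|ι|` columns. -/
def Generic [Fintype ι] (B : M → ι → ℝ) (b : ι → ℝ) : Prop :=
  ∀ T : Finset M, T.card < Fintype.card ι → b ∉ Submodule.span ℝ (B '' T)

lemma sum_smul_mem_span (B : M → ι → ℝ) {α : M → ℝ} {T : Finset M} (h : ∀ m ∉ T, α m = 0) :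
    ∑ m, α m • B m ∈ Submodule.span ℝ (B '' T) := by
  refine Submodule.sum_mem _ fun m _ => ?_
  by_cases hm : m ∈ T
  · exact Submodule.smul_mem _ _ (Submodule.subset_span ⟨m, hm, rfl⟩)
  · simp [h m hm]

variable [Fintype ι] [DecidableEq M] {B : M → ι → ℝ} {b : ι → ℝ}

lemma Generic.ne_zero (hb : Generic B b) {J : Finset M} (hJ : J.card = Fintype.card ι)
    {α : M → ℝ} (hα : ∀ m ∉ J, α m = 0) (hs : ∑ m, α m • B m = b) {m : M} (hm : m ∈ J) :
    α m ≠ 0 := by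
  intro h0
  refine hb (J.erase m) (by rw [card_erase_of_mem hm, ← hJ]; have := card_pos.2 ⟨m, hm⟩; omega) ?_
  rw [← hs]
  refine sum_smul_mem_span B fun k hk => ?_
  by_cases hkm : k = m
  · rw [hkm, h0]
  · exact hα k fun hkJ => hk (mem_erase.2 ⟨hkm, hkJ⟩)

/-- A nonzero relation could be scaled and subtracted from a representation of `b` so as to cancel
one weight, against `Generic.ne_zero`. -/
lemma Generic.eq_zero_of_sum_eq_zero (hb : Generic B b) {J : Finset M}
    (hJ : J.card = Fintype.card ι) (hf : Feasible B b J) {γ : M → ℝ} (hγ : ∀ m ∉ J, γ m = 0)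
    (hs : ∑ m, γ m • B m = 0) : γ = 0 := by
  obtain ⟨α, -, hα, hαs⟩ := hf
  ext m
  by_contra hm
  simp only [Pi.zero_apply] at hm
  have hmJ : m ∈ J := by
    by_contra h
    exact hm (hγ m h)
  refine hb.ne_zero hJ (α := α - (α m / γ m) • γ) (fun k hk => ?_) ?_ hmJ ?_
  · simp [hα k hk, hγ k hk]
  · simp only [Pi.sub_apply, Pi.smul_apply, sub_smul, sum_sub_distrib, hαs, smul_assoc,
      ← smul_sum, hs, smul_zero, sub_zero]
  · simp [hm]

-- If one such set is feasible, the representations of `b` supported on `K` form a line `α + t • γ`,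
-- and the nonnegative ones form a segment. Its two ends are the feasible sets `K.erase j`; by
-- genericity only one weight vanishes at each end.
open Classical in
lemma even_card_feasible_erase (hB : ∀ m i, 0 ≤ B m i) (hB' : ∀ m, ∃ i, 0 < B m i)
    (hb : Generic B b) {K : Finset M} (hK : K.card = Fintype.card ι + 1) :
    Even (K.filter fun j => Feasible B b (K.erase j)).card := by
  rcases Finset.eq_empty_or_nonempty (K.filter fun j => Feasible B b (K.erase j)) with h | ⟨j0, hj0⟩
  · simp [h]
  rw [mem_filter] at hj0
  obtain ⟨hj0K, hj0f⟩ := hj0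
  have hcard : ∀ j ∈ K, (K.erase j).card = Fintype.card ι := fun j hj => by
    rw [card_erase_of_mem hj, hK]; rfl
  obtain ⟨γ, hγK, hγs, hγ0⟩ : ∃ γ : M → ℝ, (∀ m ∉ K, γ m = 0) ∧ ∑ m, γ m • B m = 0 ∧ γ j0 = 1 := by
    have hdep : ¬ LinearIndependent ℝ (fun k : K => B k) := by
      intro h
      have := h.fintype_card_le_finrank
      simp [hK] at this
    obtain ⟨g, hg, ⟨k, hk⟩, hgk⟩ := Fintype.not_linearIndependent_iff.1 hdep
    let γ : M → ℝ := fun m => if h : m ∈ K then g ⟨m, h⟩ else 0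
    have hγK : ∀ m ∉ K, γ m = 0 := fun m hm => by simp [γ, hm]
    have hγs : ∑ m, γ m • B m = 0 := by
      rw [← hg, ← sum_subset (subset_univ K) (fun m _ hm => by simp [hγK m hm]),
        ← sum_coe_sort K]
      exact sum_congr rfl fun m _ => by simp [γ]
    have hγj : γ j0 ≠ 0 := by
      intro h0
      have := hb.eq_zero_of_sum_eq_zero (hcard j0 hj0K) hj0f (γ := γ) (fun m hm => by
        by_cases hmj : m = j0
        · rw [hmj, h0]
        · exact hγK m fun h => hm (mem_erase.2 ⟨hmj, h⟩)) hγs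
      apply hgk
      have := congrFun this k
      simpa [γ, hk] using this
    refine ⟨(γ j0)⁻¹ • γ, fun m hm => by simp [hγK m hm], ?_, by simp [hγj]⟩
    simp only [Pi.smul_apply, smul_assoc, ← smul_sum, hγs, smul_zero]
  have hj0f' := hj0f
  obtain ⟨α, hα0, hαK, hαs⟩ := hj0f
  have hαj : α j0 = 0 := hαK j0 (by simp)
  -- This bounds the segment: nonnegative columns with nonnegative weights cannot cancel the nonzero
  -- column `j0`.
  obtain ⟨q, hq⟩ : ∃ q, γ q < 0 := by
    by_contra! hcon
    obtain ⟨i, hi⟩ := hB' j0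
    have h := congrFun hγs i
    simp only [Finset.sum_apply, Pi.smul_apply, smul_eq_mul, Pi.zero_apply] at h
    have := (sum_eq_zero_iff_of_nonneg fun m _ => mul_nonneg (hcon m) (hB m i)).1 h j0 (mem_univ _)
    rw [hγ0, one_mul] at this
    exact hi.ne' this
  -- Ratio test: `j1` is the first weight to reach zero as `t` grows.
  obtain ⟨j1, hj1, hmin⟩ := Finset.exists_min_image (univ.filter fun m => γ m < 0)
    (fun m => α m / (-γ m)) ⟨q, by simpa using hq⟩
  simp only [mem_filter, mem_univ, true_and] at hj1 hmin
  have hj1K : j1 ∈ K := by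
    by_contra h
    exact hj1.ne (hγK _ h)
  have hj01 : j0 ≠ j1 := by
    rintro rfl
    rw [hγ0] at hj1
    norm_num at hj1
  set t := α j1 / (-γ j1) with ht
  have ht0 : 0 ≤ t := div_nonneg (hα0 _) (neg_nonneg.2 hj1.le)
  have hset : (K.filter fun j => Feasible B b (K.erase j)) = {j0, j1} := by
    ext j
    simp only [mem_filter, mem_insert, mem_singleton]
    constructor
    · rintro ⟨hjK, δ, hδ0, hδK, hδs⟩
      by_cases hj : j = j0
      · exact Or.inl hj
      right
      -- Any other representation lies on the line, at parameter `δ j0`.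
      have hδ : δ - α - δ j0 • γ = 0 := by
        refine hb.eq_zero_of_sum_eq_zero (hcard j0 hj0K) hj0f' (fun m hm => ?_) ?_
        · by_cases hmj : m = j0
          · simp [hmj, hαj, hγ0]
          · have hmK : m ∉ K := fun h => hm (mem_erase.2 ⟨hmj, h⟩)
            simp [hαK m hm, hγK m hmK, hδK m fun h => hmK (mem_of_mem_erase h)]
        · simp only [Pi.sub_apply, Pi.smul_apply, sub_smul, sum_sub_distrib, hαs, hδs, smul_assoc,
            ← smul_sum, hγs, smul_zero, sub_self]
      have hδm : ∀ m, δ m = α m + δ j0 * γ m := fun m => by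
        have := congrFun hδ m
        simp only [Pi.sub_apply, Pi.smul_apply, smul_eq_mul, Pi.zero_apply] at this
        linarith
      have hδj0 : 0 < δ j0 := lt_of_le_of_ne (hδ0 _) (hb.ne_zero (hcard j hjK) hδK hδs
        (mem_erase.2 ⟨fun h => hj h.symm, hj0K⟩)).symm
      have hαj' : 0 < α j := lt_of_le_of_ne (hα0 _) (hb.ne_zero (hcard j0 hj0K) hαK hαs
        (mem_erase.2 ⟨hj, hjK⟩)).symm
      have hδj : α j + δ j0 * γ j = 0 := by rw [← hδm, hδK j (by simp)]
      have hγj : γ j < 0 := by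
        by_contra! h
        have := mul_nonneg hδj0.le h
        linarith
      have h1 : t ≤ δ j0 := by
        refine (hmin j hγj).trans (le_of_eq ?_)
        rw [div_eq_iff (neg_ne_zero.2 hγj.ne)]
        linarith
      have h2 : δ j1 ≤ 0 := by
        have e : t * γ j1 = -α j1 := by
          rw [ht, div_mul_eq_mul_div, div_eq_iff (neg_ne_zero.2 hj1.ne)]
          ring
        have := mul_le_mul_of_nonpos_right h1 hj1.le
        rw [hδm]
        linarith
      by_contra hjj
      exact hb.ne_zero (hcard j hjK) hδK hδs (mem_erase.2 ⟨fun h => hjj h.symm, hj1K⟩)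
        (le_antisymm h2 (hδ0 _))
    · rintro (rfl | rfl)
      · exact ⟨hj0K, hj0f'⟩
      · refine ⟨hj1K, α + t • γ, fun m => ?_, fun m hm => ?_, ?_⟩
        · simp only [Pi.add_apply, Pi.smul_apply, smul_eq_mul]
          rcases le_or_gt 0 (γ m) with h | h
          · exact add_nonneg (hα0 m) (mul_nonneg ht0 h)
          · have := hmin m h
            rw [le_div_iff₀ (neg_pos.2 h)] at this
            linarith
        · simp only [Pi.add_apply, Pi.smul_apply, smul_eq_mul]
          by_cases hmj : m = j
          · rw [hmj, ht, div_mul_eq_mul_div, add_eq_zero_iff_eq_neg, eq_neg_iff_add_eq_zero,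
              add_div' _ _ _ (neg_ne_zero.2 hj1.ne)]
            simp
          · have hmK : m ∉ K := fun h => hm (mem_erase.2 ⟨hmj, h⟩)
            rw [hγK m hmK, hαK m fun h => hmK (mem_of_mem_erase h)]
            simp
        · simp only [Pi.add_apply, Pi.smul_apply, add_smul, sum_add_distrib, hαs, smul_assoc,
            ← smul_sum, hγs, smul_zero, add_zero]
  rw [hset, card_pair hj01]
  exact even_two

end Feasible

/-! ### Double counting, Scarf's lemma and Scarf's theorem. -/

section Parity

lemma sum_powersetCard_sum_compl {M : Type*} [Fintype M] [DecidableEq M] (p : ℕ)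
    (f : Finset M → M → ℕ) :
    ∑ E ∈ powersetCard p univ, ∑ k ∈ Eᶜ, f E k =
      ∑ D ∈ powersetCard (p + 1) univ, ∑ j ∈ D, f (D.erase j) j := by
  rw [sum_sigma', sum_sigma']
  refine sum_bij' (fun x _ => ⟨insert x.2 x.1, x.2⟩) (fun x _ => ⟨x.1.erase x.2, x.2⟩) ?_ ?_ ?_ ?_ ?_
  · rintro ⟨E, k⟩ h
    simp only [mem_sigma, mem_powersetCard_univ, mem_compl] at h ⊢
    exact ⟨by rw [card_insert_of_notMem h.2, h.1], mem_insert_self _ _⟩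
  · rintro ⟨D, j⟩ h
    simp only [mem_sigma, mem_powersetCard_univ, mem_compl] at h ⊢
    exact ⟨by rw [card_erase_of_mem h.2, h.1]; rfl, notMem_erase _ _⟩
  · rintro ⟨E, k⟩ h
    simp only [mem_sigma, mem_powersetCard_univ, mem_compl] at h
    simp [erase_insert h.2]
  · rintro ⟨D, j⟩ h
    simp only [mem_sigma] at h
    simp [insert_erase h.2]
  · rintro ⟨E, k⟩ h
    simp only [mem_sigma, mem_powersetCard_univ, mem_compl] at h
    simp [erase_insert h.2]

lemma dense_generic {M ι : Type*} [Fintype M] [Fintype ι] (B : M → ι → ℝ) : Dense {b | Generic B b} := by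
  have : {b | Generic B b} = ⋂ T : Finset M, {b | T.card < Fintype.card ι →
      b ∉ Submodule.span ℝ (B '' T)} := by
    ext b; simp [Generic]
  rw [this]
  have key : ∀ T : Finset M, T.card < Fintype.card ι →
      {b | T.card < Fintype.card ι → b ∉ Submodule.span ℝ (B '' T)}
        = (Submodule.span ℝ (B '' T) : Set (ι → ℝ))ᶜ := fun T hT => by
    ext b; simp [hT]
  apply dense_iInter_of_isOpen
  · intro T
    by_cases hT : T.card < Fintype.card ι
    · rw [key T hT]
      exact (Submodule.closed_of_finiteDimensional _).isOpen_compl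
    · simp [hT]
  · intro T
    by_cases hT : T.card < Fintype.card ι
    · rw [key T hT, ← interior_eq_empty_iff_dense_compl, Set.eq_empty_iff_forall_notMem]
      intro x hx
      have htop := Submodule.eq_top_of_nonempty_interior' _ ⟨x, hx⟩
      have h3 := finrank_span_le_card (R := ℝ) (B '' (T : Set M))
      rw [htop, finrank_top, Module.finrank_fintype_fun_eq_card, Set.toFinset_card] at h3
      have h4 : Fintype.card ↑(B '' (T : Set M)) ≤ T.card := by
        classical
        rw [← Set.toFinset_card, Set.toFinset_image, Finset.toFinset_coe]
        exact card_image_le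
      omega
    · simp [hT]

variable {ι κ α : Type*} [LinearOrder α] [Fintype ι] [DecidableEq ι] [DecidableEq κ]

lemma card_unitsExcept (r : ι) : (unitsExcept κ r).card + 1 = Fintype.card ι := by
  rw [unitsExcept, card_image_of_injective _ Sum.inl_injective, card_erase_of_mem (mem_univ r),
    card_univ]
  exact Nat.sub_add_cancel (Fintype.card_pos_iff.2 ⟨r⟩)

variable [Fintype κ]

lemma feasible_image_inl {B : ι ⊕ κ → ι → ℝ} (hu : ∀ i, B (Sum.inl i) = Pi.single i 1)
    {b : ι → ℝ} (hb : ∀ i, 0 < b i) : Feasible B b (univ.image Sum.inl) := by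
  refine ⟨Sum.elim b 0, ?_, ?_, ?_⟩
  · rintro (i | k)
    · exact (hb i).le
    · simp
  · rintro (i | k) h
    · simp at h
    · simp
  · ext i
    simp [hu, Finset.sum_apply, Pi.single_apply]

/-- Scarf's lemma for a right-hand side in general position. -/
lemma exists_feasible_dominating_of_generic [Nonempty ι]
    {c : ι → ι ⊕ κ → α} (hc : ∀ i, Function.Injective (c i))
    (h1 : ∀ i m, m ≠ Sum.inl i → c i (Sum.inl i) < c i m)
    (h2 : ∀ i j k, j ≠ i → c i (Sum.inr k) < c i (Sum.inl j))
    {B : ι ⊕ κ → ι → ℝ} (hB : ∀ m i, 0 ≤ B m i) (hB' : ∀ m, ∃ i, 0 < B m i)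
    (hu : ∀ i, B (Sum.inl i) = Pi.single i 1)
    {b : ι → ℝ} (hb0 : ∀ i, 0 < b i) (hb : Generic B b) :
    ∃ J, Feasible B b J ∧ Dominating c J := by
  classical
  by_contra! hcon
  obtain ⟨r⟩ := ‹Nonempty ι›
  let R : ι ⊕ κ := Sum.inl r
  obtain ⟨p, hp⟩ : ∃ p, p + 1 = Fintype.card ι := ⟨_, card_unitsExcept (κ := κ) r⟩
  -- Counts the pairs with `insert R E` feasible and `insert k E` dominating, both differing from
  -- `E` by one column. Grouped by `E` the total is odd; grouped by `D = insert k E` it is even.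
  let f : Finset (ι ⊕ κ) → ι ⊕ κ → ℕ := fun E k =>
    if R ∉ E ∧ k ≠ R ∧ Feasible B b (insert R E) ∧ Dominating c (insert k E) then 1 else 0
  have hL : Odd (∑ E ∈ powersetCard p univ, ∑ k ∈ Eᶜ, f E k) := by
    have hR : R ∉ unitsExcept κ r := by
      rw [mem_unitsExcept]
      rintro ⟨i, hi, h⟩
      exact hi (Sum.inl.inj h)
    have hins : insert R (unitsExcept κ r) = univ.image Sum.inl := by
      rw [unitsExcept, ← image_insert, insert_erase (mem_univ r)]
    have hval : ∀ E, R ∉ E → Feasible B b (insert R E) → ∑ k ∈ Eᶜ, f E k =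
        (univ.filter fun k => k ∉ E ∧ Dominating c (insert k E)).card := by
      intro E hRE hf
      rw [card_filter, ← sum_subset (subset_univ Eᶜ)]
      · refine sum_congr rfl fun k hk => ?_
        rw [mem_compl] at hk
        -- For `k = R` a dominating `insert R E` would also be feasible, which `hcon` excludes.
        by_cases hkR : k = R
        · subst hkR
          simp [f, hcon _ hf]
        · simp [f, hRE, hkR, hf, hk]
      · intro k _ hk
        simp at hk
        simp [hk]
    have hmem : unitsExcept κ r ∈ powersetCard p univ := by
      rw [mem_powersetCard_univ]
      have := card_unitsExcept (κ := κ) r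
      omega
    rw [← add_sum_erase _ _ hmem, hval _ hR (hins ▸ feasible_image_inl hu hb0),
      card_dominating_insert_unitsExcept hc h1 h2]
    refine odd_one.add_even (even_sum _ fun E hE => ?_)
    rw [mem_erase, mem_powersetCard_univ] at hE
    by_cases hRE : R ∈ E
    · simp [f, hRE]
    by_cases hf : Feasible B b (insert R E)
    · rw [hval E hRE hf]
      by_cases hq : ∃ q, Sum.inr q ∈ E
      · obtain ⟨q, hq⟩ := hq
        exact even_card_dominating_insert hc h2 (by omega) hq
      · refine absurd (Finset.eq_of_subset_of_card_le ?_ ?_) hE.1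
        · rintro (i | q) h
          · exact mem_unitsExcept.2 ⟨i, fun hir => hRE (show Sum.inl r ∈ E from hir ▸ h), rfl⟩
          · exact absurd ⟨q, h⟩ hq
        · have := card_unitsExcept (κ := κ) r
          omega
    · simp [f, hf]
  have hReven : Even (∑ D ∈ powersetCard (p + 1) univ, ∑ j ∈ D, f (D.erase j) j) := by
    refine even_sum _ fun D hD => ?_
    rw [mem_powersetCard_univ] at hD
    by_cases hd : Dominating c D
    · by_cases hRD : R ∈ D
      · convert Even.zero
        refine sum_eq_zero fun j hj => ?_
        by_cases hjR : j = R
        · simp [f, hjR]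
        · simp [f, hRD, Ne.symm hjR]
      · have := even_card_feasible_erase hB hB' hb (K := insert R D) (by
          rw [card_insert_of_notMem hRD]; omega)
        suffices h : ∑ j ∈ D, f (D.erase j) j =
            ((insert R D).filter fun j => Feasible B b ((insert R D).erase j)).card by rwa [h]
        -- The term at `R` concerns feasibility of `D` itself and vanishes by `hcon`.
        rw [card_filter, sum_insert hRD, erase_insert hRD, if_neg fun h => hcon D h hd, zero_add]
        refine sum_congr rfl fun j hj => ?_
        have hjR : j ≠ R := fun h => hRD (h ▸ hj)
        simp only [f]
        rw [insert_erase hj, erase_insert_of_ne hjR.symm]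
        simp [hRD, hjR, hd]
    · convert Even.zero
      refine sum_eq_zero fun j hj => ?_
      simp only [f]
      rw [insert_erase hj]
      simp [hd]
  rw [sum_powersetCard_sum_compl] at hL
  exact (Nat.not_even_iff_odd.2 hL) hReven

/-- **Scarf's lemma**. -/
theorem exists_feasible_dominating [Nonempty ι]
    {c : ι → ι ⊕ κ → α} (hc : ∀ i, Function.Injective (c i))
    (h1 : ∀ i m, m ≠ Sum.inl i → c i (Sum.inl i) < c i m)
    (h2 : ∀ i j k, j ≠ i → c i (Sum.inr k) < c i (Sum.inl j))
    {B : ι ⊕ κ → ι → ℝ} (hB : ∀ m i, 0 ≤ B m i) (hB' : ∀ m, ∃ i, 0 < B m i)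
    (hu : ∀ i, B (Sum.inl i) = Pi.single i 1)
    {b : ι → ℝ} (hb0 : ∀ i, 0 < b i) :
    ∃ J, Feasible B b J ∧ Dominating c J := by
  choose ψ hψ using hB'
  -- Weights supported on some dominating set. Row `ψ m` bounds the weight of column `m` for all
  -- right-hand sides below `b + 1`, so the set is compact and generic approximations of `b` have a
  -- limit.
  let Q : Set (ι ⊕ κ → ℝ) := ⋃ J ∈ {J | Dominating c J},
    Set.Icc 0 (fun m => (b (ψ m) + 1) / B m (ψ m)) ∩ ⋂ m ∉ J, {a | a m = 0}
  have hQ : IsCompact Q := by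
    refine (Set.toFinite _).isCompact_biUnion fun J _ => isCompact_Icc.inter_right ?_
    exact isClosed_biInter fun m _ => isClosed_eq (continuous_apply m) continuous_const
  have hcont : Continuous fun a : ι ⊕ κ → ℝ => ∑ m, a m • B m := by fun_prop
  have hC := (hQ.image hcont).isClosed
  let U : Set (ι → ℝ) := Set.univ.pi fun i => Set.Ioo 0 (b i + 1)
  have hU : IsOpen U := isOpen_set_pi Set.finite_univ fun i _ => isOpen_Ioo
  have hbU : b ∈ U := fun i _ => ⟨hb0 i, by simp⟩
  have hsub : U ∩ {b | Generic B b} ⊆ (fun a : ι ⊕ κ → ℝ => ∑ m, a m • B m) '' Q := by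
    rintro b' ⟨hb'U, hb'g⟩
    obtain ⟨J, ⟨a, ha0, haJ, has⟩, hd⟩ := exists_feasible_dominating_of_generic hc h1 h2 hB
      (fun m => ⟨_, hψ m⟩) hu (fun i => (hb'U i trivial).1) hb'g
    refine ⟨a, ?_, has⟩
    simp only [Q, Set.mem_iUnion]
    refine ⟨J, hd, ⟨fun m => ha0 m, fun m => ?_⟩, by simpa using haJ⟩
    rw [le_div_iff₀ (hψ m)]
    have h3 : a m * B m (ψ m) ≤ b' (ψ m) := by
      rw [← has, Finset.sum_apply]
      exact single_le_sum (f := fun m' => (a m' • B m') (ψ m))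
        (fun m' _ => mul_nonneg (ha0 m') (hB m' _)) (mem_univ m)
    exact h3.trans (hb'U (ψ m) trivial).2.le
  obtain ⟨a, ha, has⟩ := closure_minimal hsub hC
    ((dense_generic B).open_subset_closure_inter hU hbU)
  simp only [Q, Set.mem_iUnion] at ha
  obtain ⟨J, hd, ⟨ha0, -⟩, haJ⟩ := ha
  exact ⟨J, ⟨a, fun m => ha0 m, by simpa using haJ, has⟩, hd⟩

/-- **Scarf's theorem** in its finite form: if each `k` offers the payoffs `w k i` to the members
`i` of the coalition `P k`, then there are balancing weights and a payoff vector that is below the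
offers with positive weight and is blocked by no offer. -/
theorem exists_balanced_unblocked (P : κ → Finset ι) (hP : ∀ k, (P k).Nonempty) (w : κ → ι → ℝ)
    (hsing : ∀ i, ∃ k, P k = {i}) :
    ∃ (a : κ → ℝ) (x : ι → ℝ), (∀ k, 0 ≤ a k) ∧
      (∀ i, ∑ k, (if i ∈ P k then a k else 0) = 1) ∧
      (∀ k, a k ≠ 0 → ∀ i ∈ P k, x i ≤ w k i) ∧ ∀ k, ∃ i ∈ P k, w k i ≤ x i := by
  rcases isEmpty_or_nonempty ι with hι | hι
  · refine ⟨0, 0, by simp, fun i => hι.elim i, by simp, fun k => ?_⟩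
    obtain ⟨i, -⟩ := hP k
    exact hι.elim i
  obtain ⟨R, hR⟩ : ∃ R : ℝ, 0 < R ∧ ∀ k i, |w k i| < R := by
    refine ⟨1 + ∑ k, ∑ i, |w k i|, by positivity, fun k i => ?_⟩
    have h3 : |w k i| ≤ ∑ i, |w k i| :=
      single_le_sum (f := fun i => |w k i|) (fun i _ => abs_nonneg _) (mem_univ i)
    have h4 : ∑ i, |w k i| ≤ ∑ k, ∑ i, |w k i| :=
      single_le_sum (f := fun k => ∑ i, |w k i|)
        (fun k _ => sum_nonneg fun i _ => abs_nonneg _) (mem_univ k)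
    linarith
  obtain ⟨hR0, hR⟩ := hR
  -- Row `i` places its own unit column below all offers and the other unit columns above them. A
  -- coalition without `i` gets the top offer value `R`, so row `i` cannot be the one that rules it
  -- out.
  let val : ι → ι ⊕ κ → ℝ := fun i => Sum.elim (fun j => if j = i then -R else R + 1)
    (fun k => if i ∈ P k then w k i else R)
  let e := Fintype.equivFin (ι ⊕ κ)
  -- Ties are broken by the index, which makes each ranking injective.
  let c : ι → ι ⊕ κ → ℝ ×ₗ Fin (Fintype.card (ι ⊕ κ)) := fun i m => toLex (val i m, e m)
  let B : ι ⊕ κ → ι → ℝ := Sum.elim (fun i => Pi.single i 1) (fun k i => if i ∈ P k then 1 else 0)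
  have hclt : ∀ i m m', val i m < val i m' → c i m < c i m' := fun i m m' h =>
    Prod.Lex.toLex_lt_toLex.2 (Or.inl h)
  have hcle : ∀ i m m', c i m ≤ c i m' → val i m ≤ val i m' := fun i m m' h => by
    rcases Prod.Lex.toLex_le_toLex.1 h with h | h
    · exact h.le
    · exact h.1.le
  have hval : ∀ i k, -R < val i (Sum.inr k) ∧ val i (Sum.inr k) ≤ R := by
    intro i k
    have := abs_lt.1 (hR k i)
    simp only [val, Sum.elim_inr]
    split_ifs
    · exact ⟨this.1, this.2.le⟩
    · exact ⟨by linarith, le_rfl⟩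
  have h1 : ∀ i m, m ≠ Sum.inl i → c i (Sum.inl i) < c i m := by
    rintro i (j | k) h
    · refine hclt _ _ _ ?_
      have : j ≠ i := fun h' => h (by rw [h'])
      simp only [val, Sum.elim_inl, if_true, this, if_false]
      linarith
    · refine hclt _ _ _ ?_
      have := (hval i k).1
      simpa only [val, Sum.elim_inl, if_true] using this
  have h2 : ∀ i j k, j ≠ i → c i (Sum.inr k) < c i (Sum.inl j) := by
    intro i j k h
    refine hclt _ _ _ ((hval i k).2.trans_lt ?_)
    simp [val, h]
  have hB : ∀ m i, 0 ≤ B m i := by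
    rintro (j | k) i
    · simp only [B, Sum.elim_inl, Pi.single_apply]
      split_ifs <;> norm_num
    · simp only [B, Sum.elim_inr]
      split_ifs <;> norm_num
  have hB' : ∀ m, ∃ i, 0 < B m i := by
    rintro (j | k)
    · exact ⟨j, by simp [B]⟩
    · obtain ⟨i, hi⟩ := hP k
      exact ⟨i, by simp [B, hi]⟩
  obtain ⟨J, ⟨a, ha0, haJ, has⟩, hd⟩ := exists_feasible_dominating (c := c) (B := B) (b := 1)
    (fun i m m' h => e.injective (congrArg (fun z => (ofLex z).2) h)) h1 h2 hB hB'
    (fun i => rfl) (fun i => one_pos)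
  have hd' : ∀ l, ∃ i, ∀ j ∈ J, val i l ≤ val i j := fun l => by
    obtain ⟨i, hi⟩ := hd l
    exact ⟨i, fun j hj => hcle _ _ _ (hi j hj)⟩
  have hcov : ∀ i, ∃ m ∈ J, val i m < R := by
    intro i
    have h := congrFun has i
    rw [Finset.sum_apply, Pi.one_apply] at h
    obtain ⟨m, -, hm⟩ := exists_ne_zero_of_sum_ne_zero (h.trans_ne one_ne_zero)
    simp only [Pi.smul_apply, smul_eq_mul] at hm
    refine ⟨m, by_contra fun hmJ => left_ne_zero_of_mul hm (haJ m hmJ), ?_⟩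
    have hm := right_ne_zero_of_mul hm
    rcases m with j | k
    · have : i = j := by
        by_contra hij
        exact hm (by simp [B, hij])
      subst this
      simp only [val, Sum.elim_inl, if_true]
      linarith
    · have : i ∈ P k := by
        by_contra hik
        exact hm (by simp [B, hik])
      simp only [val, Sum.elim_inr, this, if_true]
      exact (abs_lt.1 (hR k i)).2
  have hJ : J.Nonempty := by
    obtain ⟨i⟩ := hι
    obtain ⟨m, hm, -⟩ := hcov i
    exact ⟨m, hm⟩
  have hblock : ∀ k, ∃ i ∈ P k, ∀ j ∈ J, w k i ≤ val i j := by
    intro k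
    obtain ⟨i, hi⟩ := hd' (Sum.inr k)
    have hik : i ∈ P k := by
      by_contra hik
      obtain ⟨m, hm, hmR⟩ := hcov i
      have := hi m hm
      simp only [val, Sum.elim_inr, hik, if_false] at this
      exact absurd hmR (not_lt.2 this)
    refine ⟨i, hik, fun j hj => ?_⟩
    have := hi j hj
    simpa only [val, Sum.elim_inr, hik, if_true] using this
  -- If `Sum.inl i` were in `J`, row `i` would have minimum `-R`, below the offer of the singleton
  -- `{i}`. So unit columns carry no weight and the weights balance exactly.
  have hinl : ∀ i, a (Sum.inl i) = 0 := by
    intro i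
    refine haJ _ fun hiJ => ?_
    obtain ⟨k, hk⟩ := hsing i
    obtain ⟨i', hi', h⟩ := hblock k
    rw [hk, mem_singleton] at hi'
    subst hi'
    have := h _ hiJ
    simp only [val, Sum.elim_inl, if_true] at this
    linarith [(abs_lt.1 (hR k i')).1]
  refine ⟨fun k => a (Sum.inr k), fun i => J.inf' hJ (val i), fun k => ha0 _, fun i => ?_, ?_, ?_⟩
  · have h := congrFun has i
    rw [Finset.sum_apply, Pi.one_apply, Fintype.sum_sum_type] at h
    simpa [hinl, B] using h
  · intro k hk i hi
    have hkJ : Sum.inr k ∈ J := by_contra fun h => hk (haJ _ h)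
    refine (inf'_le (val i) hkJ).trans ?_
    simp [val, hi]
  · intro k
    obtain ⟨i, hi, h⟩ := hblock k
    exact ⟨i, hi, le_inf' _ _ h⟩

end Parity

end ScarfLemma

namespace BargainingGame

open Finset

/-! ### Mixed strategies and separable expected payoffs. -/

section Strategies

variable {n : ℕ} (B : BargainingGame n) (v : ∀ i j : Fin n, B.Act j → ℝ)

lemma exists_isProfile : ∃ σ, B.IsProfile σ := by
  classical
  exact ⟨fun i => Pi.single (Classical.arbitrary _) 1, fun i => single_mem_stdSimplex ℝ _⟩

lemma isCompact_setOf_isProfile : IsCompact {σ | B.IsProfile σ} := by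
  have : {σ | B.IsProfile σ} = Set.univ.pi fun i => stdSimplex ℝ (B.Act i) := by
    ext σ; simp [IsProfile]
  rw [this]
  exact isCompact_univ_pi fun i => isCompact_stdSimplex ℝ _

lemma exists_isProfile_eqOn {P : Finset (Fin n)} {σ : ∀ i, B.Act i → ℝ}
    (hσ : ∀ i ∈ P, σ i ∈ stdSimplex ℝ (B.Act i)) : ∃ τ, B.IsProfile τ ∧ ∀ i ∈ P, τ i = σ i := by
  obtain ⟨ρ, hρ⟩ := B.exists_isProfile
  refine ⟨P.piecewise σ ρ, fun i => ?_, fun i hi => piecewise_eq_of_mem _ _ _ hi⟩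
  by_cases hi : i ∈ P
  · rw [piecewise_eq_of_mem _ _ _ hi]
    exact hσ i hi
  · rw [piecewise_eq_of_notMem _ _ _ hi]
    exact hρ i

@[fun_prop]
lemma continuous_contribution (i j : Fin n) : Continuous (B.contribution v i j) := by
  unfold contribution
  fun_prop

lemma contribution_add_smul_sub (i j : Fin n) (s t t' : B.Act j → ℝ) (ε : ℝ) :
    B.contribution v i j (s + ε • (t - t')) =
      B.contribution v i j s + ε * (B.contribution v i j t - B.contribution v i j t') := by
  simp only [contribution, mul_sub, mul_sum, ← sum_sub_distrib, ← sum_add_distrib]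
  refine sum_congr rfl fun a _ => ?_
  simp only [Pi.add_apply, Pi.smul_apply, Pi.sub_apply, smul_eq_mul]
  ring

lemma contribution_sum_smul {κ : Type*} (i j : Fin n) (t : Finset κ) (c : κ → ℝ)
    (s : κ → B.Act j → ℝ) :
    B.contribution v i j (∑ k ∈ t, c k • s k) = ∑ k ∈ t, c k * B.contribution v i j (s k) := by
  simp only [contribution, Finset.sum_apply, Pi.smul_apply, smul_eq_mul, sum_mul, mul_sum]
  rw [sum_comm]
  exact sum_congr rfl fun _ _ => sum_congr rfl fun _ _ => mul_assoc _ _ _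

lemma abs_contribution_le (i j : Fin n) {s : B.Act j → ℝ} (hs : s ∈ stdSimplex ℝ (B.Act j)) :
    |B.contribution v i j s| ≤ ∑ a, |v i j a| := by
  refine (abs_sum_le_sum_abs _ _).trans (sum_le_sum fun a _ => ?_)
  rw [abs_mul, abs_of_nonneg (hs.1 a)]
  refine mul_le_of_le_one_left (abs_nonneg _) ?_
  rw [← hs.2]
  exact single_le_sum (f := s) (fun a _ => hs.1 a) (mem_univ a)

variable {v}

lemma expectedUtility_eq_sum (hv : B.IsSeparation v) (i : Fin n) {σ : ∀ j, B.Act j → ℝ}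
    (hσ : B.IsProfile σ) : B.expectedUtility i σ = ∑ j, B.contribution v i j (σ j) := by
  classical
  simp only [expectedUtility, hv i, mul_sum]
  rw [sum_comm]
  refine sum_congr rfl fun j _ => ?_
  -- Absorbing the payoff into factor `j` turns the sum of products into a product of sums, whose
  -- other factors are 1.
  let f : ∀ k, B.Act k → ℝ := Function.update σ j fun a => σ j a * v i j a
  have h1 : ∀ a : ∀ k, B.Act k, (∏ k, σ k (a k)) * v i j (a j) = ∏ k, f k (a k) := by
    intro a
    rw [← mul_prod_erase _ _ (mem_univ j), ← mul_prod_erase _ _ (mem_univ j)]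
    have : ∏ k ∈ univ.erase j, f k (a k) = ∏ k ∈ univ.erase j, σ k (a k) :=
      prod_congr rfl fun k hk => by simp [f, Function.update_of_ne (ne_of_mem_erase hk)]
    rw [this]
    simp only [f, Function.update_self]
    ring
  simp only [h1]
  rw [← Fintype.piFinset_univ, ← prod_univ_sum, ← mul_prod_erase _ _ (mem_univ j)]
  have : ∏ k ∈ univ.erase j, ∑ a, f k a = 1 :=
    prod_eq_one fun k hk => by simp [f, Function.update_of_ne (ne_of_mem_erase hk), (hσ k).2]
  rw [this, mul_one]
  simp [f, contribution]

end Strategies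

/-! ### Pareto optimal choices and worst-case payoffs. -/

section Pareto

variable {n : ℕ} {B : BargainingGame n} {v : ∀ i j : Fin n, B.Act j → ℝ} {P : Finset (Fin n)}

/-- Pareto optimality depends only on the supports of the strategies. -/
lemma IsParetoOptimal.of_support {σ σ' : ∀ i, B.Act i → ℝ} (h : B.IsParetoOptimal v P σ)
    (hσ' : ∀ i ∈ P, σ' i ∈ stdSimplex ℝ (B.Act i))
    (hs : ∀ i ∈ P, ∀ a, σ i a = 0 → σ' i a = 0) : B.IsParetoOptimal v P σ' := by
  refine ⟨hσ', fun τ hτ hdom => ?_⟩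
  -- Since `σ'` uses only actions that `σ` uses, `σ + ε • (τ - σ')` consists of mixed strategies for
  -- small `ε`. By linearity, an improvement of `τ` on `σ'` would be an improvement on `σ`.
  obtain ⟨ε, hε, hε0⟩ : ∃ ε : ℝ, (∀ i, ∀ a, i ∈ P → ε * σ' i a ≤ σ i a) ∧ 0 < ε := by
    have : ∀ᶠ ε in nhdsWithin (0 : ℝ) (Set.Ioi 0), ∀ i, ∀ a, i ∈ P → ε * σ' i a ≤ σ i a := by
      simp only [Filter.eventually_all]
      intro i a hi
      by_cases h0 : σ i a = 0
      · simp [h0, hs i hi a h0]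
      · have hpos : 0 < σ i a := lt_of_le_of_ne ((h.1 i hi).1 a) (Ne.symm h0)
        have hc : Filter.Tendsto (fun ε : ℝ => ε * σ' i a) (nhds 0) (nhds (0 * σ' i a)) :=
          (continuous_id.mul continuous_const).tendsto 0
        rw [zero_mul] at hc
        exact ((hc.eventually_lt_const hpos).filter_mono nhdsWithin_le_nhds).mono
          fun _ h => h.le
    exact (this.and self_mem_nhdsWithin).exists
  have hsum : ∀ j, ∑ i ∈ P, B.contribution v j i (σ i + ε • (τ i - σ' i)) =
      ∑ i ∈ P, B.contribution v j i (σ i) + ε * (∑ i ∈ P, B.contribution v j i (τ i) -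
        ∑ i ∈ P, B.contribution v j i (σ' i)) := fun j => by
    simp only [contribution_add_smul_sub, sum_add_distrib, ← mul_sum, sum_sub_distrib]
  have := h.2 (fun i => σ i + ε • (τ i - σ' i)) (fun i hi => ⟨fun a => ?_, ?_⟩) fun j hj => ?_
  · intro j hj
    have h1 := this j hj
    rw [hsum, add_eq_left, mul_eq_zero, sub_eq_zero] at h1
    exact h1.resolve_left hε0.ne'
  · simp only [Pi.add_apply, Pi.smul_apply, Pi.sub_apply, smul_eq_mul]
    have h1 := hε i a hi
    have h2 := mul_nonneg hε0.le ((hτ i hi).1 a)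
    linarith
  · simp only [Pi.add_apply, Pi.smul_apply, Pi.sub_apply, smul_eq_mul, sum_add_distrib, ← mul_sum,
      sum_sub_distrib, (h.1 i hi).2, (hτ i hi).2, (hσ' i hi).2]
    ring
  · rw [hsum, le_add_iff_nonneg_right]
    exact mul_nonneg hε0.le (sub_nonneg.2 (hdom j hj))

lemma IsParetoOptimal.congr {σ σ' : ∀ i, B.Act i → ℝ} (h : B.IsParetoOptimal v P σ)
    (hs : ∀ i ∈ P, σ' i = σ i) : B.IsParetoOptimal v P σ' :=
  h.of_support (fun i hi => hs i hi ▸ h.1 i hi) fun i hi a ha => by rw [hs i hi, ha]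

variable (v P) in
lemma isCompact_setOf_isParetoOptimal :
    IsCompact {σ | B.IsProfile σ ∧ B.IsParetoOptimal v P σ} := by
  refine B.isCompact_setOf_isProfile.of_isClosed_subset ?_ fun σ h => h.1
  rw [← closure_subset_iff_isClosed]
  intro σ hσ
  have hp : B.IsProfile σ := closure_minimal (fun σ h => h.1)
    B.isCompact_setOf_isProfile.isClosed hσ
  -- Close to `σ` supports can only grow, so optimality of a nearby `τ` passes to `σ`.
  have hev : ∀ᶠ τ in nhds σ, ∀ i, ∀ a, σ i a ≠ 0 → τ i a ≠ 0 := by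
    simp only [Filter.eventually_all]
    intro i a ha
    have hc : Continuous fun τ : ∀ i, B.Act i → ℝ => τ i a := by fun_prop
    exact (hc.tendsto σ).eventually_ne ha
  obtain ⟨τ, ⟨-, hτ⟩, hs⟩ := ((mem_closure_iff_frequently.1 hσ).and_eventually hev).exists
  exact ⟨hp, hτ.of_support (fun i _ => hp i) fun i _ a ha => by_contra fun h => hs i a h ha⟩

lemma exists_isParetoOptimal_ge {σ : ∀ i, B.Act i → ℝ}
    (hσ : ∀ i ∈ P, σ i ∈ stdSimplex ℝ (B.Act i)) :
    ∃ τ, B.IsProfile τ ∧ B.IsParetoOptimal v P τ ∧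
      ∀ j ∈ P, ∑ i ∈ P, B.contribution v j i (σ i) ≤ ∑ i ∈ P, B.contribution v j i (τ i) := by
  obtain ⟨σ₀, hσ₀, hσ₀P⟩ := B.exists_isProfile_eqOn hσ
  have hsum : ∀ {σ₁ σ₂ : ∀ i, B.Act i → ℝ}, (∀ i ∈ P, σ₁ i = σ₂ i) → ∀ j,
      ∑ i ∈ P, B.contribution v j i (σ₁ i) = ∑ i ∈ P, B.contribution v j i (σ₂ i) :=
    fun h j => sum_congr rfl fun i hi => by rw [h i hi]
  let K : Set (∀ i, B.Act i → ℝ) := {τ | B.IsProfile τ} ∩ ⋂ j ∈ P,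
    {τ | ∑ i ∈ P, B.contribution v j i (σ i) ≤ ∑ i ∈ P, B.contribution v j i (τ i)}
  have hK : IsCompact K := B.isCompact_setOf_isProfile.inter_right <|
    isClosed_biInter fun j _ => isClosed_le (by fun_prop) (by fun_prop)
  -- Maximize the members' total payoff among the profiles that are at least as good as `σ` for each
  -- member.
  obtain ⟨τ, ⟨hτ, hτσ⟩, hmax⟩ := hK.exists_isMaxOn (f := fun τ => ∑ j ∈ P, ∑ i ∈ P,
    B.contribution v j i (τ i)) ⟨σ₀, hσ₀, by simpa using fun j _ => (hsum hσ₀P j).ge⟩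
    (by fun_prop)
  simp only [Set.mem_iInter, Set.mem_ofPred_eq] at hτσ
  refine ⟨τ, hτ, ⟨fun i _ => hτ i, fun ρ hρ hdom j hj => ?_⟩, hτσ⟩
  obtain ⟨ρ₀, hρ₀, hρ₀P⟩ := B.exists_isProfile_eqOn hρ
  have hρK : ρ₀ ∈ K := ⟨hρ₀, by
    simpa using fun j hj => (hτσ j hj).trans ((hdom j hj).trans (hsum hρ₀P j).ge)⟩
  have h1 : ∑ j ∈ P, ∑ i ∈ P, B.contribution v j i (ρ i) ≤
      ∑ j ∈ P, ∑ i ∈ P, B.contribution v j i (τ i) := by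
    simpa only [hsum hρ₀P] using isMaxOn_iff.1 hmax ρ₀ hρK
  exact ((sum_eq_sum_iff_of_le hdom).1 (le_antisymm (sum_le_sum hdom) h1) j hj).symm

lemma isLeast_paretoPayoffs (v : ∀ i j : Fin n, B.Act j → ℝ) (P : Finset (Fin n)) (i j : Fin n)
    (hi : i ∈ P) : IsLeast (B.paretoPayoffs v P i j) (sInf (B.paretoPayoffs v P i j)) := by
  have himage : B.paretoPayoffs v P i j = (fun σ : ∀ i, B.Act i → ℝ => B.contribution v j i (σ i)) ''
      {σ | B.IsProfile σ ∧ B.IsParetoOptimal v P σ} := by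
    ext r
    constructor
    · rintro ⟨σ, hσ, rfl⟩
      obtain ⟨τ, hτ, hτσ⟩ := B.exists_isProfile_eqOn hσ.1
      exact ⟨τ, ⟨hτ, hσ.congr hτσ⟩, by simp only [hτσ i hi]⟩
    · rintro ⟨σ, ⟨-, hσ⟩, rfl⟩
      exact ⟨σ, hσ, rfl⟩
  rw [himage]
  refine ((isCompact_setOf_isParetoOptimal v P).image (by fun_prop)).isLeast_sInf
    (Set.Nonempty.image _ ?_)
  obtain ⟨σ, hσ⟩ := B.exists_isProfile
  obtain ⟨τ, h1, h2, -⟩ := exists_isParetoOptimal_ge (v := v) (P := P) fun i _ => hσ i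
  exact ⟨τ, h1, h2⟩

/-- Balancedness uses this for `j` outside `P`. -/
lemma IsParetoOptimal.worstCase_le {σ : ∀ i, B.Act i → ℝ} (h : B.IsParetoOptimal v P σ) {i : Fin n}
    (hi : i ∈ P) (j : Fin n) : B.worstCase v i j ≤ B.contribution v j i (σ i) :=
  (inf'_le _ (by simpa using hi)).trans ((isLeast_paretoPayoffs v P i j hi).2 ⟨σ, h, rfl⟩)

variable (v) in
lemma exists_contribution_eq_worstCase (i j : Fin n) :
    ∃ s ∈ stdSimplex ℝ (B.Act i), B.contribution v j i s = B.worstCase v i j := by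
  obtain ⟨P, hP, h⟩ := exists_mem_eq_inf' (s := univ.filter fun P : Finset (Fin n) => i ∈ P)
    ⟨univ, by simp⟩ fun P => sInf (B.paretoPayoffs v P i j)
  have hi : i ∈ P := by simpa using hP
  obtain ⟨σ, hσ, hσe⟩ := (isLeast_paretoPayoffs v P i j hi).1
  exact ⟨σ i, hσ.1 i hi, by rw [worstCase, h, hσe]⟩

end Pareto

/-! ### Balancedness and nonemptiness of the cores. -/

section Core

variable {n : ℕ} (B : BargainingGame n) (v : ∀ i j : Fin n, B.Act j → ℝ)

/-- The payoff of `i` when the members `j` of `P` play `σ j` and each other player `j` produces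
`A j i` for `i`. -/
noncomputable def coalitionPayoff (A : Fin n → Fin n → ℝ) (P : Finset (Fin n))
    (σ : ∀ i, B.Act i → ℝ) (i : Fin n) : ℝ :=
  ∑ j ∈ P, B.contribution v i j (σ j) + ∑ j ∈ Pᶜ, A j i

lemma coalitionPayoff_eq_sum_ite (A : Fin n → Fin n → ℝ) (P : Finset (Fin n))
    (σ : ∀ i, B.Act i → ℝ) (i : Fin n) : B.coalitionPayoff v A P σ i =
      ∑ j, if j ∈ P then B.contribution v i j (σ j) else A j i := by
  rw [coalitionPayoff, ← sum_add_sum_compl P]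
  congr 1
  · exact sum_congr rfl fun j hj => by rw [if_pos hj]
  · exact sum_congr rfl fun j hj => by rw [if_neg (mem_compl.1 hj)]

lemma abs_coalitionPayoff_le (A : Fin n → Fin n → ℝ) (P : Finset (Fin n))
    {σ : ∀ i, B.Act i → ℝ} (hσ : B.IsProfile σ) (i : Fin n) :
    |B.coalitionPayoff v A P σ i| ≤ ∑ j, (∑ a, |v i j a| + |A j i|) := by
  rw [coalitionPayoff_eq_sum_ite]
  refine (abs_sum_le_sum_abs _ _).trans (sum_le_sum fun j _ => ?_)
  split_ifs
  · exact (B.abs_contribution_le v i j (hσ j)).trans (le_add_of_nonneg_right (abs_nonneg _))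
  · exact le_add_of_nonneg_left (sum_nonneg fun a _ => abs_nonneg _)

variable {v}

/-- The game of finitely many coalitional choices is balanced: the payoff vector provided by Scarf's
theorem is feasible for the grand coalition. -/
lemma exists_unblocked_of_fintype {κ : Type*} [Fintype κ] {A : Fin n → Fin n → ℝ}
    (P : κ → Finset (Fin n)) (hP : ∀ k, (P k).Nonempty) (hsing : ∀ i, ∃ k, P k = {i})
    (σ : κ → ∀ i, B.Act i → ℝ) (hσ : ∀ k, B.IsProfile (σ k))
    (hA : ∀ k, ∀ j ∈ P k, ∀ i, A j i ≤ B.contribution v i j (σ k j)) :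
    ∃ (x : Fin n → ℝ) (τ : ∀ i, B.Act i → ℝ), B.IsProfile τ ∧
      (∀ i, x i ≤ ∑ j, B.contribution v i j (τ j)) ∧
      (∀ i, ∃ k, x i ≤ B.coalitionPayoff v A (P k) (σ k) i) ∧
      ∀ k, ∃ i ∈ P k, B.coalitionPayoff v A (P k) (σ k) i ≤ x i := by
  classical
  obtain ⟨a, x, ha0, ha1, hax, hx⟩ := ScarfLemma.exists_balanced_unblocked P hP
    (fun k i => B.coalitionPayoff v A (P k) (σ k) i) hsing
  let d : Fin n → κ → ℝ := fun i k => if i ∈ P k then a k else 0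
  have hd0 : ∀ i k, 0 ≤ d i k := fun i k => by
    simp only [d]
    split_ifs
    exacts [ha0 k, le_rfl]
  refine ⟨x, fun j => ∑ k, d j k • σ k j, fun j => ?_, fun i => ?_, fun i => ?_, hx⟩
  · exact (convex_stdSimplex ℝ _).sum_mem (fun k _ => hd0 j k) (ha1 j) fun k _ => hσ k j
  · simp only [contribution_sum_smul]
    have h1 : x i ≤ ∑ k, d i k * B.coalitionPayoff v A (P k) (σ k) i := by
      rw [← one_mul (x i), ← ha1 i, sum_mul]
      refine sum_le_sum fun k _ => ?_
      by_cases hik : i ∈ P k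
      · simp only [d, hik, if_true]
        rcases eq_or_ne (a k) 0 with h0 | h0
        · simp [h0]
        · exact mul_le_mul_of_nonneg_left (hax k h0 i hik) (ha0 k)
      · simp [d, hik]
    refine h1.trans ?_
    simp only [coalitionPayoff_eq_sum_ite, mul_sum]
    rw [sum_comm]
    refine sum_le_sum fun j _ => ?_
    -- Coalitions with `i` only and with `j` only have equal total weight. Adding this zero reduces
    -- the inequality to one for each `k`, where `hA` settles the case of `j` only.
    have h2 : ∑ k, A j i * (d i k - d j k) = 0 := by
      rw [← mul_sum, sum_sub_distrib, ha1 i, ha1 j, sub_self, mul_zero]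
    rw [← add_zero (∑ k, d j k * _), ← h2, ← sum_add_distrib]
    refine sum_le_sum fun k _ => ?_
    by_cases hi : i ∈ P k <;> by_cases hj : j ∈ P k <;> simp only [d, hi, hj, if_true, if_false]
    · simp
    · linarith
    · have := mul_le_mul_of_nonneg_left (hA k j hj i) (ha0 k)
      linarith
    · simp
  · obtain ⟨k, -, hk⟩ := exists_ne_zero_of_sum_ne_zero ((ha1 i).trans_ne one_ne_zero)
    have hik : i ∈ P k := by_contra fun h => hk (if_neg h)
    rw [if_pos hik] at hk
    exact ⟨k, hax k hk i hik⟩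

variable (v)

theorem matCore_worstCase_nonempty : (B.matCore v (B.worstCase v)).Nonempty := by
  classical
  set A := B.worstCase v
  -- Infinitely many potential objections: each cuts out a closed set `C q`, and the finite
  -- intersection property on the compact `K` meets all of them.
  let Q := {q : Finset (Fin n) × (∀ i, B.Act i → ℝ) //
    q.1.Nonempty ∧ B.IsProfile q.2 ∧ B.IsParetoOptimal v q.1 q.2}
  let R : Fin n → ℝ := fun i => ∑ j, (∑ a, |v i j a| + |A j i|)
  have hR : ∀ (q : Q) i, |B.coalitionPayoff v A q.1.1 q.1.2 i| ≤ R i := fun q i =>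
    B.abs_coalitionPayoff_le v A q.1.1 q.2.2.1 i
  let K : Set ((Fin n → ℝ) × (∀ i, B.Act i → ℝ)) :=
    Set.Icc (-R) R ×ˢ {τ | B.IsProfile τ} ∩
      ⋂ i, {z | z.1 i ≤ ∑ j, B.contribution v i j (z.2 j)}
  have hK : IsCompact K := (isCompact_Icc.prod B.isCompact_setOf_isProfile).inter_right <|
    isClosed_iInter fun i => isClosed_le (by fun_prop) (by fun_prop)
  let C : Q → Set ((Fin n → ℝ) × (∀ i, B.Act i → ℝ)) := fun q =>
    ⋃ i ∈ q.1.1, {z | B.coalitionPayoff v A q.1.1 q.1.2 i ≤ z.1 i}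
  have hC : ∀ q, IsClosed (C q) := fun q => q.1.1.finite_toSet.isClosed_biUnion fun i _ =>
    isClosed_le (by fun_prop) (by fun_prop)
  have hsing : ∀ i : Fin n, ∃ q : Q, q.1.1 = {i} := fun i => by
    obtain ⟨ρ, hρ⟩ := B.exists_isProfile
    obtain ⟨σ, h1, h2, -⟩ := exists_isParetoOptimal_ge (v := v) (P := {i}) fun i _ => hρ i
    exact ⟨⟨({i}, σ), singleton_nonempty i, h1, h2⟩, rfl⟩
  choose q₀ hq₀ using hsing
  obtain ⟨⟨x, τ⟩, hxK, hxC⟩ := hK.inter_iInter_nonempty C hC fun T => by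
    -- The singletons are required by Scarf's theorem and also bound `x` from below, uniformly in
    -- `T`.
    let T' := T ∪ univ.image q₀
    obtain ⟨x, τ, hτ, hxτ, hxle, hx⟩ := B.exists_unblocked_of_fintype (κ := T') (v := v) (A := A)
      (fun q => q.1.1.1) (fun q => q.1.2.1)
      (fun i => ⟨⟨q₀ i, mem_union_right _ (mem_image_of_mem _ (mem_univ i))⟩, hq₀ i⟩)
      (fun q => q.1.1.2) (fun q => q.1.2.2.1) (fun q j hj i => q.1.2.2.2.worstCase_le hj i)
    refine ⟨(x, τ), ⟨⟨⟨fun i => ?_, fun i => ?_⟩, hτ⟩, by simpa using hxτ⟩, ?_⟩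
    · obtain ⟨i', hi', h⟩ := hx ⟨q₀ i, mem_union_right _ (mem_image_of_mem _ (mem_univ i))⟩
      simp only [hq₀ i, mem_singleton] at hi'
      subst hi'
      exact (abs_le.1 (hR (q₀ i') i')).1.trans h
    · obtain ⟨k, hk⟩ := hxle i
      exact hk.trans (abs_le.1 (hR k.1 i)).2
    · simp only [Set.mem_iInter]
      intro q hq
      obtain ⟨i, hi, h⟩ := hx ⟨q, mem_union_left _ hq⟩
      exact Set.mem_biUnion hi h
  simp only [K, Set.mem_inter_iff, Set.mem_iInter, Set.mem_ofPred_eq] at hxK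
  refine ⟨x, ⟨fun j i => B.contribution v i j (τ j), fun j _ => ⟨τ j, hxK.1.2 j, fun i => rfl⟩,
    fun i _ => by simpa using hxK.2 i⟩, fun P hP y hy => ?_⟩
  obtain ⟨z, hz, hyz⟩ := hy
  choose! s hs hsz using hz
  -- An arbitrary objection is replaced by a Pareto optimal one at least as good for every member.
  obtain ⟨σ, hσ, hσP, hσs⟩ := exists_isParetoOptimal_ge (v := v) hs
  have := Set.mem_iInter.1 hxC ⟨(P, σ), hP, hσ, hσP⟩
  simp only [C, Set.mem_iUnion] at this
  obtain ⟨i, hi, h⟩ := this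
  refine ⟨i, hi, (hyz i hi).trans (le_trans ?_ h)⟩
  rw [coalitionPayoff, sum_congr rfl fun j hj => hsz j hj i]
  exact add_le_add_left (hσs i hi) _

lemma matCore_worstCase_subset_alphaCore (hv : B.IsSeparation v) :
    B.matCore v (B.worstCase v) ⊆ B.alphaCore := by
  rintro x ⟨⟨y, hy, hxy⟩, hx⟩
  refine ⟨?_, fun P hP z hz => hx P hP z ?_⟩
  · choose! s hs hsy using hy
    have hs' : B.IsProfile s := fun j => hs j (mem_univ j)
    refine ⟨s, hs', fun τ _ i _ => ?_⟩
    rw [piecewise_univ, B.expectedUtility_eq_sum hv i hs']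
    simpa [hsy] using hxy i (mem_univ i)
  · obtain ⟨σ, hσ, h⟩ := hz
    refine ⟨fun j i => B.contribution v i j (σ j), fun j _ => ⟨σ j, hσ j, fun i => rfl⟩,
      fun i hi => ?_⟩
    -- The punishment `τ` is aimed at the single player `i`; this suffices, since `α`-effectiveness
    -- protects each member against every `τ`.
    choose τ hτ hτA using fun j => exists_contribution_eq_worstCase v j i
    have hp : B.IsProfile (P.piecewise σ τ) := fun j => by
      by_cases hj : j ∈ P
      · rw [piecewise_eq_of_mem _ _ _ hj]
        exact hσ j
      · rw [piecewise_eq_of_notMem _ _ _ hj]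
        exact hτ j
    refine (h τ hτ i hi).trans_eq ?_
    rw [B.expectedUtility_eq_sum hv i hp, ← sum_add_sum_compl P]
    congr 1
    · exact sum_congr rfl fun j hj => by rw [piecewise_eq_of_mem _ _ _ hj]
    · exact sum_congr rfl fun j hj => by
        rw [piecewise_eq_of_notMem _ _ _ (mem_compl.1 hj), hτA]

end Core

end BargainingGame

theorem mainTheorem5 {n : ℕ} (B : BargainingGame n) (v : ∀ i j : Fin n, B.Act j → ℝ)
    (hv : B.IsSeparation v) :
    -- the minima that define the matrix of worst-case payoffs are attained
    (∀ (P : Finset (Fin n)) (i j : Fin n), i ∈ P →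
      IsLeast (B.paretoPayoffs v P i j) (sInf (B.paretoPayoffs v P i j))) ∧
    (B.matCore v (B.worstCase v)).Nonempty ∧
    B.alphaCore.Nonempty :=
  ⟨BargainingGame.isLeast_paretoPayoffs v, B.matCore_worstCase_nonempty v,
    (B.matCore_worstCase_nonempty v).mono (B.matCore_worstCase_subset_alphaCore v hv)⟩
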